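/- Let $n\ge 1$, let $b_2,\dots,b_n\in\mathbb C$, and consider the homogeneous rational differential operator $$L_0=\partial^n+b_2z^{-2}\partial^{n-2}+\dots+b_nz^{-n},\qquad \partial=\frac{d}{dz},$$ on a nonempty open interval $I\subset\mathbb R$ with $0\notin I$. Call $L_0$ algebraically integrable (on $I$) if there is a nonzero differential operator $M=\sum_{k=0}^{m}c_k(z)\partial^k$ with smooth complex-valued coefficients on $I$ whose order $m$ is relatively prime to $n$ and which satisfies $[L_0,M]=0$. The indices $m_0,\dots,m_{n-1}$ of $L_0$ are the complex roots, with multiplicities, of the polynomial $$P(s)=s(s-1)\cdots(s-n+1)+\sum_{i=2}^{n}b_i\,s(s-1)\cdots(s-n+i+1)$$ (an empty product is $1$). Then, for every such interval $I$, the operator $L_0$ is algebraically integrable if and only if the indices $m_0,\dots,m_{n-1}$ are all integers and are pairwise distinct modulo $n$. -/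

import Mathlib

open scoped ContDiff

noncomputable section

/-- A linear ordinary differential operator `∑_{k=0}^{m} c_k(x) ∂^k` of order exactly `m` on
the set `I ⊆ ℝ` (in practice a nonempty open interval), with smooth complex-valued coefficients;
the leading coefficient `c_m` is not identically zero on `I`. Only the coefficients `c_k` with
`k ≤ m`, and only their values on `I`, are relevant. -/
structure DiffOp (I : Set ℝ) (m : ℕ) where
  /-- the coefficient of `∂^k` -/
  coeff : ℕ → ℝ → ℂ
  smooth : ∀ k ≤ m, ContDiffOn ℝ ∞ (coeff k) I
  leading_ne_zero : ∃ x ∈ I, coeff m x ≠ 0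

/-- The action of a differential operator on functions: `(M f)(x) = ∑_{k ≤ m} c_k(x) f^{(k)}(x)`.
For open `I`, the values of `M f` on `I` depend only on the restriction of `f` to `I`. -/
def DiffOp.act {I : Set ℝ} {m : ℕ} (M : DiffOp I m) (f : ℝ → ℂ) : ℝ → ℂ :=
  fun x => ∑ k ∈ Finset.range (m + 1), M.coeff k x * iteratedDeriv k f x

/-- `[L, M] = 0` as operators on the smooth complex-valued functions on `I`. -/
def DiffOp.Commutes {I : Set ℝ} {n m : ℕ} (L : DiffOp I n) (M : DiffOp I m) : Prop :=
  ∀ f : ℝ → ℂ, ContDiffOn ℝ ∞ f I → Set.EqOn (L.act (M.act f)) (M.act (L.act f)) I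

/-- `L` is algebraically integrable: it commutes with some (nonzero) differential operator whose
order is relatively prime to the order of `L`. -/
def DiffOp.AlgebraicallyIntegrable {I : Set ℝ} {n : ℕ} (L : DiffOp I n) : Prop :=
  ∃ m : ℕ, m.Coprime n ∧ ∃ M : DiffOp I m, L.Commutes M

/-- The coefficient of `∂^k`, `k ≤ n`, in the homogeneous rational operator
`∂^n + b_2 z^{-2} ∂^{n-2} + ⋯ + b_n z^{-n}`. -/
def homogeneousCoeff (n : ℕ) (b : ℕ → ℂ) (k : ℕ) (x : ℝ) : ℂ :=
  if k = n then 1 else if k + 1 = n then 0 else b (n - k) / (x : ℂ) ^ (n - k)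

theorem homogeneousCoeff_smooth (n : ℕ) (b : ℕ → ℂ) (k : ℕ) {I : Set ℝ} (h0 : (0 : ℝ) ∉ I) :
    ContDiffOn ℝ ∞ (homogeneousCoeff n b k) I := by
  unfold homogeneousCoeff
  split_ifs
  · exact contDiffOn_const
  · exact contDiffOn_const
  · have hp : ContDiffOn ℝ ∞ (fun x : ℝ => (x : ℂ) ^ (n - k)) I :=
      Complex.ofRealCLM.contDiff.contDiffOn.pow _
    simp only [div_eq_mul_inv]
    refine contDiffOn_const.mul (hp.inv ?_)
    intro x hx
    have hx0 : x ≠ 0 := fun h => h0 (h ▸ hx)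
    exact pow_ne_zero _ (Complex.ofReal_ne_zero.mpr hx0)

/-- The homogeneous rational operator `L₀ = ∂^n + b_2 z^{-2} ∂^{n-2} + ⋯ + b_n z^{-n}` on a
nonempty set `I ⊆ ℝ` that does not contain the pole `0`. Only `b_2, …, b_n` occur. -/
def homogeneousOp (n : ℕ) (b : ℕ → ℂ) (I : Set ℝ) (hI : I.Nonempty) (h0 : (0 : ℝ) ∉ I) :
    DiffOp I n where
  coeff := homogeneousCoeff n b
  smooth := fun k _ => homogeneousCoeff_smooth n b k h0
  leading_ne_zero := by
    obtain ⟨x, hx⟩ := hI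
    exact ⟨x, hx, by simp [homogeneousCoeff]⟩

/-- The indicial polynomial
`P(s) = s(s-1)⋯(s-n+1) + b_2 s(s-1)⋯(s-n+3) + ⋯ + b_{n-1} s + b_n`;
`descPochhammer ℂ j` is the falling factorial `s(s-1)⋯(s-j+1)`. -/
def indicialPoly (n : ℕ) (b : ℕ → ℂ) : Polynomial ℂ :=
  descPochhammer ℂ n + ∑ i ∈ Finset.Icc 2 n, Polynomial.C (b i) * descPochhammer ℂ (n - i)

/-- The indices: the complex roots of the indicial polynomial, with multiplicities. -/
def indices (n : ℕ) (b : ℕ → ℂ) : Multiset ℂ := (indicialPoly n b).roots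

end

open Polynomial

/-! With `θ = z∂` the operator is `z⁻ⁿ P(θ)`, and `z⁻ᵐ Q(θ)` commutes with it as soon as `P(s - m)
Q(s) = P(s) Q(s - n)`. The theorem reduces to this functional equation.

From a commuting `M` of order `m` with arbitrary smooth coefficients, write `M zˢ = zˢ g_s`.
Commutation gives `P(θ + s) g_s = P(s) g_{s-n}`. The numbers `(θʲ g_s)(x₀)` at a fixed point are
polynomials in `s` of degree at most `m`, related by a recurrence in `j`. The shift `E` in `j` acts
on the solutions triangularly with respect to degree; projecting to its eigenvalue `-m` gives a
nonzero `Q` (`exists_shift_eq_of_mem`, `exists_shift_eq_of_commute`).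

Modulo `nℤ` the roots of `Q` cancel, so the roots of `P` are invariant under translation by `m`. As
`m` is prime to `n`, they fill the `n` classes of a coset of `ℤ` once each; their sum, fixed by the
missing `∂ⁿ⁻¹` term, makes them integers. Conversely, distinct residues allow an explicit
telescoping `Q` (`exists_shift_eq_of_residues`). -/

/-! ### Roots and the functional equation -/

/-- Shifting the argument of a monic polynomial translates its roots. -/
theorem roots_comp_X_sub_C (P : ℂ[X]) (c : ℂ) :
    (P.comp (X - C c)).roots = P.roots.map (· + c) := by
  ext a
  have h : (a : ℂ) = (a - c) + c := by ring
  conv_rhs => rw [h]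
  rw [Multiset.count_map_eq_count' (· + c) _ (add_left_injective c), count_roots, count_roots]
  by_cases hP : P = 0
  · simp [hP]
  have := rootMultiplicity_eq_rootMultiplicity (p := P.comp (X - C c)) (t := a)
  rw [this, rootMultiplicity_eq_rootMultiplicity (p := P) (t := a - c), comp_assoc]
  congr 2
  simp
  ring

/-- A system of `n` representatives of the residue classes, from the functional equation
`P(s - m) Q(s) = P(s) Q(s - n)`. -/
theorem exists_roots_of_shift_eq {n m : ℕ} (hn : 1 ≤ n) (hmn : m.Coprime n) {P Q : ℂ[X]}
    (hP : P.Monic) (hPn : P.natDegree = n) (hQ : Q ≠ 0)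
    (h : P.comp (X - C (m : ℂ)) * Q = P * Q.comp (X - C (n : ℂ))) :
    ∃ (α : ℂ) (k : Fin n → ℤ),
      P.roots = (Finset.univ : Finset (Fin n)).val.map
        (fun i : Fin n => α + ((i : ℕ) : ℂ) + (k i : ℂ) * n) := by
  have hn0 : (n : ℂ) ≠ 0 := by exact_mod_cast (by omega : n ≠ 0)
  have hcomp : ∀ (R : ℂ[X]) (c : ℂ), R ≠ 0 → R.comp (X - C c) ≠ 0 := by
    intro R c hR h0
    apply hR
    have : (R.comp (X - C c)).comp (X + C c) = 0 := by rw [h0, zero_comp]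
    simpa [comp_assoc] using this
  have hroots : P.roots.map (· + (m : ℂ)) + Q.roots = P.roots + Q.roots.map (· + (n : ℂ)) := by
    rw [← roots_comp_X_sub_C, ← roots_comp_X_sub_C,
      ← roots_mul (mul_ne_zero (hcomp _ _ hP.ne_zero) hQ),
      ← roots_mul (mul_ne_zero hP.ne_zero (hcomp _ _ hQ)), h]
  -- Modulo `nℤ` the shift by `n` disappears and the roots of `Q` cancel from both sides of
  -- `hroots`.
  let π : ℂ →+ ℂ ⧸ AddSubgroup.zmultiples (n : ℂ) := QuotientAddGroup.mk' _
  have hπn : π n = 0 := by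
    rw [← AddMonoidHom.mem_ker, QuotientAddGroup.ker_mk']
    exact AddSubgroup.mem_zmultiples _
  have hinv : (P.roots.map π).map (· + π m) = P.roots.map π := by
    have := congrArg (Multiset.map π) hroots
    simp only [Multiset.map_add, Multiset.map_map, Function.comp_def, map_add, hπn, add_zero]
      at this
    simpa [Multiset.map_map, Function.comp_def] using this
  have hcard : P.roots.card = n := by
    rw [← hPn]; exact (IsAlgClosed.splits P).natDegree_eq_card_roots.symm
  obtain ⟨α, hα⟩ : ∃ α, α ∈ P.roots := by
    apply Multiset.card_pos_iff_exists_mem.mp; omega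
  have hmem : ∀ j : ℕ, π α + j • π m ∈ P.roots.map π := by
    intro j
    induction j with
    | zero => simpa using Multiset.mem_map_of_mem π hα
    | succ j ih =>
      rw [← hinv, succ_nsmul, ← add_assoc]
      exact Multiset.mem_map_of_mem (· + π m) ih
  -- Since `m` is invertible modulo `n`, the orbit of `α` under translation by `m` meets each class
  -- `α + i`.
  have hex : ∀ i : Fin n, ∃ k : ℤ, α + ((i : ℕ) : ℂ) + (k : ℂ) * n ∈ P.roots := by
    intro i
    obtain ⟨j, hj⟩ : ∃ j : ℕ, j * m ≡ i [MOD n] := by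
      obtain ⟨j, hj⟩ := Nat.exists_mul_mod_eq_of_coprime (k := n) (n := m) i hmn (by omega)
      exact ⟨j, by rw [mul_comm]; exact hj.2⟩
    obtain ⟨x, hx, hxe⟩ := Multiset.mem_map.mp (hmem j)
    rw [← map_nsmul, ← map_add] at hxe
    have h1 : -(α + j • (m : ℂ)) + x ∈ AddSubgroup.zmultiples (n : ℂ) :=
      QuotientAddGroup.eq.mp hxe.symm
    obtain ⟨k, hk⟩ := AddSubgroup.mem_zmultiples_iff.mp h1
    obtain ⟨l, hl⟩ := (Nat.modEq_iff_dvd.mp hj)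
    refine ⟨k - l, ?_⟩
    have hl' : ((i : ℕ) : ℂ) - (j : ℂ) * m = n * l := by exact_mod_cast congrArg (Int.cast (R := ℂ)) hl
    simp only [zsmul_eq_mul, nsmul_eq_mul] at hk
    have : α + ((i : ℕ) : ℂ) + ((k - l : ℤ) : ℂ) * n = x := by
      push_cast
      linear_combination hk + hl'
    rwa [this]
  choose k hk using hex
  refine ⟨α, k, ?_⟩
  symm
  apply Multiset.eq_of_le_of_card_le
  · refine (Multiset.le_iff_subset ?_).mpr ?_
    · refine Multiset.Nodup.map ?_ (Finset.nodup _)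
      intro i j hij
      have h1 : (((i : ℕ) : ℤ) + k i * n : ℤ) = ((j : ℕ) : ℤ) + k j * n := by
        have : (((i : ℕ) : ℂ) + k i * n : ℂ) = ((j : ℕ) : ℂ) + k j * n := by
          linear_combination hij
        exact_mod_cast this
      have h2 : ((i : ℕ) : ℤ) % n = ((j : ℕ) : ℤ) % n := by
        have := congrArg (· % (n : ℤ)) h1
        simpa using this
      rw [Int.emod_eq_of_lt (by positivity) (by exact_mod_cast i.2),
        Int.emod_eq_of_lt (by positivity) (by exact_mod_cast j.2)] at h2
      exact Fin.ext (by exact_mod_cast h2)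
    · intro x hx
      obtain ⟨i, -, rfl⟩ := Multiset.mem_map.mp hx
      exact hk i
  · simp [hcard]

/-- If the roots of `P` represent each residue class modulo `n` once, then
`P(s - m) Q(s) = P(s) Q(s - n)` for some `m` prime to `n` and some monic `Q` of degree `m`. -/
theorem exists_shift_eq_of_residues {n : ℕ} (hn : 1 ≤ n) (a : Fin n → ℤ)
    (ha : ∀ i j : Fin n, i ≠ j → ¬ (a i ≡ a j [ZMOD (n : ℤ)])) :
    ∃ m : ℕ, m.Coprime n ∧ ∃ Q : ℂ[X], Q.Monic ∧ Q.natDegree = m ∧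
      (∏ i, (X - C (a i : ℂ))).comp (X - C (m : ℂ)) * Q =
        (∏ i, (X - C (a i : ℂ))) * Q.comp (X - C (n : ℂ)) := by
  have : NeZero n := ⟨by omega⟩
  -- `K` bounds every `|a i - a j|`. Then `m = 1 + n * K` is prime to `n` and large enough that the
  -- `k` below are nonnegative.
  let K : ℕ := ∑ i, 2 * (a i).natAbs
  have hK : ∀ i, 2 * (a i).natAbs ≤ K := fun i =>
    Finset.single_le_sum (f := fun i => 2 * (a i).natAbs) (fun _ _ => Nat.zero_le _)
      (Finset.mem_univ i)
  let m : ℕ := 1 + n * K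
  have hKn : K ≤ n * K := Nat.le_mul_of_pos_left _ (by omega)
  have hinj : Function.Injective (fun i => (a i : ZMod n)) := by
    intro i j hij
    by_contra hne
    exact ha i j hne ((ZMod.intCast_eq_intCast_iff _ _ _).mp hij)
  have hbij : Function.Bijective (fun i => (a i : ZMod n)) :=
    (Fintype.bijective_iff_injective_and_card _).mpr ⟨hinj, by simp⟩
  let e : Fin n ≃ ZMod n := Equiv.ofBijective _ hbij
  let σ : Fin n ≃ Fin n := (e.trans (Equiv.addRight (m : ZMod n))).trans e.symm
  have hσ : ∀ i, ((a (σ i) : ℤ) : ZMod n) = (a i : ZMod n) + m := by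
    intro i
    change e (σ i) = e i + m
    simp [σ]
  have hk : ∀ i, ∃ k : ℕ, a i + m = a (σ i) + n * k := by
    intro i
    have h1 : ((a (σ i) : ℤ) : ZMod n) = ((a i + m : ℤ) : ZMod n) := by rw [hσ]; push_cast; ring
    obtain ⟨k, hk⟩ := (ZMod.intCast_eq_intCast_iff_dvd_sub _ _ _).mp h1
    have h2 := hK i
    have h3 := hK (σ i)
    have hm : (m : ℤ) = 1 + (n * K : ℕ) := by simp [m]
    have hk0 : 0 ≤ k := by
      by_contra hneg
      have : (n : ℤ) * k ≤ 0 := mul_nonpos_of_nonneg_of_nonpos (by positivity) (by omega)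
      omega
    lift k to ℕ using hk0
    exact ⟨k, by linarith⟩
  choose k hk using hk
  have hsum : ∑ i, k i = m := by
    have h1 : ∑ i, (a i + m) = ∑ i, (a (σ i) + n * k i) := Finset.sum_congr rfl fun i _ => hk i
    rw [Finset.sum_add_distrib, Finset.sum_add_distrib, Equiv.sum_comp σ a,
      ← Finset.mul_sum] at h1
    simp only [Finset.sum_const, Finset.card_univ, Fintype.card_fin, nsmul_eq_mul] at h1
    have h2 : (n : ℤ) * m = n * ∑ i, (k i : ℤ) := by linarith
    have h3 := mul_left_cancel₀ (by exact_mod_cast (by omega : n ≠ 0)) h2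
    exact_mod_cast h3.symm
  -- The `i`-th block of `Q` runs in steps of `n` from `a (σ i)` up to, but not including, `a i +
  -- m`.
  refine ⟨m, by simp [m], ∏ i, ∏ j ∈ Finset.range (k i), (X - C ((a (σ i) : ℂ) + n * j)),
    monic_prod_of_monic _ _ fun i _ => monic_prod_of_monic _ _ fun j _ => monic_X_sub_C _,
    ?_, ?_⟩
  · rw [natDegree_prod_of_monic _ _ fun i _ => monic_prod_of_monic _ _ fun j _ => monic_X_sub_C _,
      ← hsum]
    refine Finset.sum_congr rfl fun i _ => ?_
    rw [natDegree_prod_of_monic _ _ fun j _ => monic_X_sub_C _]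
    simp only [natDegree_X_sub_C, Finset.sum_const, Finset.card_range, smul_eq_mul, mul_one]
  · conv_rhs => rw [← Equiv.prod_comp σ]
    rw [prod_comp, prod_comp, ← Finset.prod_mul_distrib, ← Finset.prod_mul_distrib]
    refine Finset.prod_congr rfl fun i _ => ?_
    have hki : (a i : ℂ) + m = a (σ i) + n * k i := by exact_mod_cast congrArg (Int.cast (R := ℂ)) (hk i)
    have h1 : (X - C (a i : ℂ)).comp (X - C (m : ℂ)) = X - C ((a (σ i) : ℂ) + n * (k i : ℕ)) := by
      rw [← hki]; simp only [sub_comp, X_comp, C_comp]; simp only [map_add]; ring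
    -- Both sides are the progression with `0 ≤ j ≤ k i`: the shifted factor of `P` supplies its
    -- last term, the unshifted one its first.
    rw [h1, mul_comm, ← Finset.prod_range_succ (fun j : ℕ => X - C ((a (σ i) : ℂ) + n * j)),
      Finset.prod_range_succ', prod_comp, mul_comm]
    congr 1
    · simp
    · refine Finset.prod_congr rfl fun j _ => ?_
      simp only [sub_comp, X_comp, C_comp, Nat.cast_add, Nat.cast_one]
      simp only [map_add, map_mul, map_one]
      ring

/-! ### The recurrence and the action of the shift -/

/-- The shift of a sequence of polynomials. -/
noncomputable def seqShift : Module.End ℂ (ℕ → ℂ[X]) := LinearMap.funLeft ℂ ℂ[X] (· + 1)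

@[simp] theorem seqShift_apply (F : ℕ → ℂ[X]) (j : ℕ) : seqShift F j = F (j + 1) := rfl

/-- The sequences of polynomials of degree less than `d` that satisfy the recurrence obtained by
expanding `P(E + s) F(s) = P(s) F(s - n)` in powers of the shift `E`. -/
def recurrenceSpace (P : ℂ[X]) (n d : ℕ) : Submodule ℂ (ℕ → ℂ[X]) where
  carrier := {F | (∀ j i, d ≤ i → (F j).coeff i = 0) ∧
    ∀ j, ∑ k ∈ Finset.range (n + 1), hasseDeriv k P * F (j + k) =
      P * (F j).comp (X - C (n : ℂ))}
  zero_mem' := by simp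
  add_mem' := by
    rintro F G ⟨hF, hF'⟩ ⟨hG, hG'⟩
    refine ⟨fun j i hi => by simp [hF j i hi, hG j i hi], fun j => ?_⟩
    simp only [Pi.add_apply, mul_add, Finset.sum_add_distrib, hF', hG', add_comp]
  smul_mem' := by
    rintro c F ⟨hF, hF'⟩
    refine ⟨fun j i hi => by simp [hF j i hi], fun j => ?_⟩
    simp only [Pi.smul_apply, mul_smul_comm, ← Finset.smul_sum, hF', smul_comp]

theorem seqShift_mem {P : ℂ[X]} {n d : ℕ} {F : ℕ → ℂ[X]} (hF : F ∈ recurrenceSpace P n d) :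
    seqShift F ∈ recurrenceSpace P n d := by
  refine ⟨fun j => hF.1 (j + 1), fun j => ?_⟩
  simp only [seqShift_apply]
  rw [← hF.2 (j + 1)]
  exact Finset.sum_congr rfl fun k _ => by rw [add_right_comm]

theorem aeval_seqShift_mem {P : ℂ[X]} {n d : ℕ} {F : ℕ → ℂ[X]} (hF : F ∈ recurrenceSpace P n d)
    (r : ℂ[X]) : aeval seqShift r F ∈ recurrenceSpace P n d := by
  induction r using Polynomial.induction_on' with
  | add p q hp hq => simpa using Submodule.add_mem _ hp hq
  | monomial k c =>
    rw [aeval_monomial, Module.End.mul_apply, Module.algebraMap_end_apply]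
    refine Submodule.smul_mem _ _ ?_
    induction k with
    | zero => simpa using hF
    | succ k ih => rw [pow_succ', Module.End.mul_apply]; exact seqShift_mem ih

/-- The difference `f(s) - f(s - a)` lowers the degree and has leading coefficient `a d f_d`. -/
theorem natDegree_sub_comp_le {f : ℂ[X]} {d : ℕ} (hf : f.natDegree ≤ d + 1) (a : ℂ) :
    (f - f.comp (X - C a)).natDegree ≤ d ∧
      (f - f.comp (X - C a)).coeff d = a * (d + 1) * f.coeff (d + 1) := by
  have ht : f.comp (X - C a) = taylor (-a) f := by
    rw [taylor_apply, C_neg, sub_eq_add_neg]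
  rw [ht]
  have hh : (hasseDeriv d f).natDegree ≤ 1 :=
    (natDegree_hasseDeriv_le f d).trans (by omega)
  have hh' : (hasseDeriv (d + 1) f).natDegree ≤ 0 :=
    (natDegree_hasseDeriv_le f (d + 1)).trans (by omega)
  constructor
  · rw [natDegree_le_iff_coeff_eq_zero]
    intro N hN
    rcases Nat.lt_or_ge (d + 1) N with h | h
    · rw [coeff_sub, coeff_eq_zero_of_natDegree_lt (by omega),
        coeff_eq_zero_of_natDegree_lt (by rw [natDegree_taylor]; omega), sub_zero]
    · obtain rfl : N = d + 1 := by omega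
      rw [coeff_sub, taylor_coeff, eq_C_of_natDegree_le_zero hh', eval_C, hasseDeriv_coeff]
      simp
  · rw [coeff_sub, taylor_coeff, eq_X_add_C_of_natDegree_le_one hh]
    simp only [eval_add, eval_mul, eval_C, eval_X, hasseDeriv_coeff, zero_add,
      Nat.choose_self, Nat.cast_one, one_mul, add_comm 1 d, Nat.choose_succ_self_right]
    push_cast
    ring

/-- Compare coefficients one below the top degree in the recurrence: the terms with two or more
derivatives of `P` do not reach it. What remains is `n f_{j+1} = -n d f_j` for the coefficients of
degree `d`. -/
theorem coeff_succ_of_mem {P : ℂ[X]} {n d : ℕ} (hn : 1 ≤ n) (hP : P.Monic)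
    (hPn : P.natDegree = n) {F : ℕ → ℂ[X]} (hF : F ∈ recurrenceSpace P n (d + 1)) (j : ℕ) :
    (F (j + 1)).coeff d = -d * (F j).coeff d := by
  obtain ⟨n, rfl⟩ : ∃ k, n = k + 1 := ⟨n - 1, by omega⟩
  have hdeg : ∀ j, (F j).natDegree ≤ d := fun j =>
    natDegree_le_iff_coeff_eq_zero.mpr fun N hN => hF.1 j N hN
  have hrec := hF.2 j
  rw [Finset.sum_range_succ', Finset.sum_range_succ'] at hrec
  have h := congrArg (fun f => coeff f (n + d)) hrec
  simp only [coeff_add, finsetSum_coeff, add_zero, zero_add, hasseDeriv_zero'] at h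
  have hzero : ∀ k ∈ Finset.range n,
      (hasseDeriv (k + 1 + 1) P * F (j + (k + 1 + 1))).coeff (n + d) = 0 := by
    intro k hk
    have hk' := Finset.mem_range.mp hk
    have h1 := natDegree_hasseDeriv_le P (k + 1 + 1)
    have h2 := hdeg (j + (k + 1 + 1))
    exact coeff_eq_zero_of_natDegree_lt (natDegree_mul_le.trans_lt (by omega))
  have hone : (hasseDeriv 1 P * F (j + 1)).coeff (n + d) = (n + 1) * (F (j + 1)).coeff d := by
    rw [coeff_mul_add_eq_of_natDegree_le ((natDegree_hasseDeriv_le P 1).trans (by omega)) (hdeg _),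
      hasseDeriv_coeff]
    have : P.coeff (n + 1) = 1 := by rw [← hPn]; exact hP
    simp [this]
  have hdiff : (P * (F j - (F j).comp (X - C ((n + 1 : ℕ) : ℂ)))).coeff (n + d) =
      (n + 1) * d * (F j).coeff d := by
    rcases d with _ | d
    · rw [eq_C_of_natDegree_le_zero (hdeg j)]
      simp
    · have := natDegree_sub_comp_le (hdeg j) ((n + 1 : ℕ) : ℂ)
      rw [show n + (d + 1) = n + 1 + d by ring, coeff_mul_add_eq_of_natDegree_le hPn.le this.1, this.2]
      have : P.coeff (n + 1) = 1 := by rw [← hPn]; exact hP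
      rw [this]
      push_cast
      ring
  rw [Finset.sum_eq_zero hzero, hone] at h
  rw [mul_sub, coeff_sub] at hdiff
  have hn0 : (n : ℂ) + 1 ≠ 0 := Nat.cast_add_one_ne_zero n
  apply mul_left_cancel₀ hn0
  linear_combination h - hdiff

/-- The top coefficient is an eigenvector of the shift for `-d`, so `E + d` lowers the degree bound.
Iterating, `E(E+1)⋯(E+d-1)` kills every solution of degree less than `d`. -/
theorem shift_add_mem {P : ℂ[X]} {n d : ℕ} (hn : 1 ≤ n) (hP : P.Monic)
    (hPn : P.natDegree = n) {F : ℕ → ℂ[X]} (hF : F ∈ recurrenceSpace P n (d + 1)) :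
    aeval seqShift (X + C (d : ℂ)) F ∈ recurrenceSpace P n d := by
  refine ⟨fun j i hi => ?_, (aeval_seqShift_mem hF _).2⟩
  rcases hi.eq_or_lt with rfl | hi
  · simp [coeff_succ_of_mem hn hP hPn hF j]
  · exact (aeval_seqShift_mem hF _).1 j i hi

theorem aeval_ascPochhammer_eq_zero {P : ℂ[X]} {n d : ℕ} (hn : 1 ≤ n) (hP : P.Monic)
    (hPn : P.natDegree = n) {F : ℕ → ℂ[X]} (hF : F ∈ recurrenceSpace P n d) :
    aeval seqShift (ascPochhammer ℂ d) F = 0 := by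
  induction d generalizing F with
  | zero =>
    have : F = 0 := funext fun j => Polynomial.ext fun i => by simpa using hF.1 j i (Nat.zero_le i)
    simp [this]
  | succ d ih =>
    rw [ascPochhammer_succ_right, map_mul, Module.End.mul_apply]
    simpa using ih (shift_add_mem hn hP hPn hF)

theorem coeff_aeval_seqShift {P : ℂ[X]} {n d : ℕ} (hn : 1 ≤ n) (hP : P.Monic)
    (hPn : P.natDegree = n) {F : ℕ → ℂ[X]} (hF : F ∈ recurrenceSpace P n (d + 1)) (r : ℂ[X])
    (j : ℕ) : (aeval seqShift r F j).coeff d = r.eval (-d : ℂ) * (F j).coeff d := by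
  induction r using Polynomial.induction_on' with
  | add p q hp hq => simp [hp, hq, add_mul]
  | monomial k c =>
    rw [aeval_monomial, Module.End.mul_apply, Module.algebraMap_end_apply, eval_monomial,
      Pi.smul_apply, coeff_smul, smul_eq_mul, mul_assoc]
    congr 1
    induction k generalizing j with
    | zero => simp
    | succ k ih =>
      have hk : (seqShift ^ k) F ∈ recurrenceSpace P n (d + 1) := by
        simpa using aeval_seqShift_mem hF (X ^ k)
      rw [pow_succ', Module.End.mul_apply, seqShift_apply, coeff_succ_of_mem hn hP hPn hk, ih]
      ring

/-- A solution of the recurrence of exact degree `m` yields a homogeneous one. -/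
theorem exists_shift_eq_of_mem {P : ℂ[X]} {n m : ℕ} (hn : 1 ≤ n) (hP : P.Monic)
    (hPn : P.natDegree = n) {F : ℕ → ℂ[X]} (hF : F ∈ recurrenceSpace P n (m + 1))
    (hF0 : (F 0).coeff m ≠ 0) :
    ∃ Q : ℂ[X], Q ≠ 0 ∧ P.comp (X - C (m : ℂ)) * Q = P * Q.comp (X - C (n : ℂ)) := by
  -- The last factor `E + m` is omitted: it then annihilates `G`, while the coefficient of degree
  -- `m` is only multiplied by `(-1)ᵐ m! ≠ 0`.
  set G := aeval seqShift (ascPochhammer ℂ m) F with hG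
  have hGmem : G ∈ recurrenceSpace P n (m + 1) := aeval_seqShift_mem hF _
  have hkill : ∀ j, G (j + 1) = (-m : ℂ) • G j := by
    intro j
    have h := aeval_ascPochhammer_eq_zero hn hP hPn hF
    rw [ascPochhammer_succ_right, mul_comm, map_mul, Module.End.mul_apply, ← hG] at h
    have := congrFun h j
    simp only [map_add, aeval_X, map_natCast, LinearMap.add_apply, Pi.add_apply, seqShift_apply,
      Pi.zero_apply, Module.End.natCast_apply, Pi.smul_apply] at this
    rw [eq_neg_of_add_eq_zero_left this, neg_smul, Nat.cast_smul_eq_nsmul]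
  have hpow : ∀ j, G j = (-m : ℂ) ^ j • G 0 := by
    intro j
    induction j with
    | zero => simp
    | succ j ih => rw [hkill, ih, smul_smul, pow_succ']
  refine ⟨G 0, ?_, ?_⟩
  · intro h0
    have h := coeff_aeval_seqShift hn hP hPn hF (ascPochhammer ℂ m) 0
    rw [← hG, h0, coeff_zero] at h
    refine mul_ne_zero ?_ hF0 h.symm
    rw [ascPochhammer_eval_neg_eq_descPochhammer, descPochhammer_eval_eq_descFactorial,
      Nat.descFactorial_self]
    exact mul_ne_zero (pow_ne_zero _ (by norm_num)) (by exact_mod_cast m.factorial_ne_zero)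
  · rw [← hGmem.2 0]
    -- Taylor expansion: since `G j = (-m)ʲ G 0`, the left side of the recurrence sums to `P(s - m)
    -- G 0`.
    have ht : P.comp (X - C (m : ℂ)) =
        ∑ k ∈ Finset.range (n + 1), C ((-m : ℂ) ^ k) * hasseDeriv k P := by
      refine Polynomial.funext fun x => ?_
      have h1 : (P.comp (X - C (m : ℂ))).eval x = (taylor x P).eval (-m : ℂ) := by
        rw [taylor_eval, eval_comp]; congr 1; simp; ring
      rw [h1, eval_eq_sum_range, natDegree_taylor, hPn, eval_finsetSum]
      refine Finset.sum_congr rfl fun k _ => ?_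
      rw [taylor_coeff, eval_mul, eval_C, mul_comm]
    rw [ht, Finset.sum_mul]
    refine Finset.sum_congr rfl fun k _ => ?_
    rw [zero_add, hpow k, smul_eq_C_mul]
    ring

/-! ### The indicial polynomial -/

/-- The numerators of the coefficients of the homogeneous operator. -/
noncomputable def homogeneousNumerator (n : ℕ) (b : ℕ → ℂ) (k : ℕ) : ℂ :=
  if k = n then 1 else if k + 1 = n then 0 else b (n - k)

theorem indicialPoly_eq_sum {n : ℕ} (hn : 1 ≤ n) (b : ℕ → ℂ) :
    indicialPoly n b =
      ∑ k ∈ Finset.range (n + 1), C (homogeneousNumerator n b k) * descPochhammer ℂ k := by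
  obtain ⟨n, rfl⟩ : ∃ k, n = k + 1 := ⟨n - 1, by omega⟩
  rw [Finset.sum_range_succ, Finset.sum_range_succ, indicialPoly, add_comm]
  simp only [homogeneousNumerator, if_true, C_1, one_mul]
  congr 1
  rw [if_neg (by omega), C_0, zero_mul, add_zero]
  refine Finset.sum_nbij' (fun i => n + 1 - i) (fun k => n + 1 - k) ?_ ?_ ?_ ?_ ?_
  · intro i hi; simp only [Finset.mem_Icc, Finset.mem_range] at *; omega
  · intro i hi; simp only [Finset.mem_Icc, Finset.mem_range] at *; omega
  · intro i hi; simp only [Finset.mem_Icc] at *; omega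
  · intro i hi; simp only [Finset.mem_range] at *; omega
  · intro i hi
    simp only [Finset.mem_Icc] at hi
    rw [if_neg (by omega), if_neg (by omega), show n + 1 - (n + 1 - i) = i by omega]

theorem coeff_descPochhammer_self (n : ℕ) : (descPochhammer ℂ n).coeff n = 1 := by
  have := monic_descPochhammer ℂ n
  rwa [Monic, leadingCoeff, descPochhammer_natDegree] at this

theorem natDegree_indicial_tail (n : ℕ) (b : ℕ → ℂ) :
    (∑ i ∈ Finset.Icc 2 n, C (b i) * descPochhammer ℂ (n - i)).natDegree ≤ n - 2 := by
  refine natDegree_sum_le_of_forall_le _ _ fun i hi => ?_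
  have := (Finset.mem_Icc.mp hi).1
  refine (natDegree_C_mul_le _ _).trans ?_
  rw [descPochhammer_natDegree]
  omega

theorem natDegree_indicialPoly {n : ℕ} (hn : 1 ≤ n) (b : ℕ → ℂ) :
    (indicialPoly n b).natDegree = n := by
  have h := natDegree_indicial_tail n b
  rw [indicialPoly, natDegree_add_eq_left_of_natDegree_lt] <;> rw [descPochhammer_natDegree]
  omega

theorem coeff_indicialPoly {n i : ℕ} (hi : n < i + 2) (b : ℕ → ℂ) :
    (indicialPoly n b).coeff i = (descPochhammer ℂ n).coeff i := by
  have h := natDegree_indicial_tail n b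
  rw [indicialPoly, coeff_add]
  rcases Nat.lt_or_ge n 2 with h2 | h2
  · simp [Finset.Icc_eq_empty (show ¬ 2 ≤ n by omega)]
  · rw [coeff_eq_zero_of_natDegree_lt (p := ∑ _ ∈ _, _) (by omega), add_zero]

theorem monic_indicialPoly {n : ℕ} (hn : 1 ≤ n) (b : ℕ → ℂ) : (indicialPoly n b).Monic := by
  rw [Monic, leadingCoeff, natDegree_indicialPoly hn, coeff_indicialPoly (by omega)]
  exact coeff_descPochhammer_self n

theorem nextCoeff_descPochhammer (n : ℕ) :
    (descPochhammer ℂ n).nextCoeff = -∑ k ∈ Finset.range n, (k : ℂ) := by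
  induction n with
  | zero => simp [nextCoeff]
  | succ n ih =>
    rw [descPochhammer_succ_right, ← C_eq_natCast, (monic_descPochhammer ℂ n).nextCoeff_mul
      (monic_X_sub_C _), ih, nextCoeff_X_sub_C, Finset.sum_range_succ]
    ring

/-- The tail has degree at most `n - 2`, so the sum of the roots is that of the falling factorial,
whose roots are `0, …, n-1`. -/
theorem sum_roots_indicialPoly {n : ℕ} (hn : 1 ≤ n) (b : ℕ → ℂ) :
    (indicialPoly n b).roots.sum = ∑ k ∈ Finset.range n, (k : ℂ) := by
  have h := (IsAlgClosed.splits (indicialPoly n b)).nextCoeff_eq_neg_sum_roots_of_monic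
    (monic_indicialPoly hn b)
  rw [← neg_eq_iff_eq_neg.mpr h, ← neg_eq_iff_eq_neg.mpr (nextCoeff_descPochhammer n)]
  rw [nextCoeff_of_natDegree_pos (by rw [natDegree_indicialPoly hn]; omega),
    nextCoeff_of_natDegree_pos (by rw [descPochhammer_natDegree]; omega),
    natDegree_indicialPoly hn, descPochhammer_natDegree,
    coeff_indicialPoly (by omega)]

theorem exists_descPochhammer_expansion (m : ℕ) (Q : ℂ[X]) (hQ : Q.natDegree ≤ m) :
    ∃ q : ℕ → ℂ, Q = ∑ k ∈ Finset.range (m + 1), C (q k) * descPochhammer ℂ k ∧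
      q m = Q.coeff m := by
  induction m generalizing Q with
  | zero =>
    refine ⟨fun _ => Q.coeff 0, ?_, rfl⟩
    conv_lhs => rw [eq_C_of_natDegree_le_zero hQ]
    simp
  | succ m ih =>
    obtain ⟨q, hq, -⟩ := ih (Q - C (Q.coeff (m + 1)) * descPochhammer ℂ (m + 1)) <| by
      rw [natDegree_le_iff_coeff_eq_zero]
      intro N hN
      rcases Nat.eq_or_lt_of_le hN with rfl | h
      · simp [coeff_descPochhammer_self]
      · rw [coeff_sub, coeff_C_mul, coeff_eq_zero_of_natDegree_lt (by omega),
          coeff_eq_zero_of_natDegree_lt (p := descPochhammer ℂ (m + 1))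
            (by rw [descPochhammer_natDegree]; omega), mul_zero, sub_zero]
    refine ⟨Function.update q (m + 1) (Q.coeff (m + 1)), ?_, by simp⟩
    rw [Finset.sum_range_succ, Function.update_self, ← sub_eq_iff_eq_add, hq]
    refine Finset.sum_congr rfl fun k hk => ?_
    rw [Function.update_of_ne (by have := Finset.mem_range.mp hk; omega)]

/-! ### Euler operator calculus in a differential algebra -/

section Euler

variable {A : Type*} [CommRing A] [Algebra ℂ A]

/-- The Euler operator `z ∂`. -/
noncomputable def euler (D : Derivation ℂ A A) (z : A) : Module.End ℂ A :=
  (z • D : Derivation ℂ A A).toLinearMap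

/-- The operator `∑_{k ≤ m} c_k ∂^k`. -/
noncomputable def linOp (D : Derivation ℂ A A) (m : ℕ) (c : ℕ → A) : Module.End ℂ A :=
  ∑ k ∈ Finset.range (m + 1), LinearMap.mulLeft ℂ (c k) * (D : A →ₗ[ℂ] A) ^ k

variable {D : Derivation ℂ A A} {z Z : A}

theorem euler_apply (a : A) : euler D z a = z * D a := rfl

theorem euler_mul (a b : A) : euler D z (a * b) = euler D z a * b + a * euler D z b := by
  simp only [euler_apply, Derivation.leibniz, smul_eq_mul]
  ring

theorem linOp_apply (m : ℕ) (c : ℕ → A) (a : A) :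
    linOp D m c a = ∑ k ∈ Finset.range (m + 1), c k * ((D : A →ₗ[ℂ] A) ^ k) a := by
  simp [linOp]

theorem aeval_euler_mul {w : A} {c : ℂ} (hw : euler D z w = c • w) (P : ℂ[X]) (a : A) :
    aeval (euler D z) P (w * a) = w * aeval (euler D z) (P.comp (X + C c)) a := by
  induction P using Polynomial.induction_on' with
  | add p q hp hq => simp [hp, hq, mul_add]
  | monomial k r =>
    rw [monomial_comp, aeval_monomial, Module.End.mul_apply, map_mul (aeval (euler D z)),
      Module.End.mul_apply, aeval_C, Module.algebraMap_end_apply, Module.algebraMap_end_apply, map_pow,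
      mul_smul_comm]
    congr 1
    induction k generalizing a with
    | zero => simp
    | succ k ih =>
      rw [pow_succ, Module.End.mul_apply, euler_mul, hw, pow_succ, Module.End.mul_apply,
        show c • w * a + w * euler D z a = w * aeval (euler D z) (X + C c) a by
          simp [mul_add, Module.algebraMap_end_apply, add_comm], ih]

theorem aeval_euler_eigen {w : A} {c : ℂ} (hw : euler D z w = c • w) (P : ℂ[X]) :
    aeval (euler D z) P w = P.eval c • w := by
  induction P using Polynomial.induction_on' with
  | add p q hp hq => simp [hp, hq, add_smul]
  | monomial k r =>
    rw [aeval_monomial, Module.End.mul_apply, Module.algebraMap_end_apply, eval_monomial, mul_smul]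
    congr 1
    induction k with
    | zero => simp
    | succ k ih => rw [pow_succ, Module.End.mul_apply, hw, map_smul, ih, smul_smul, ← pow_succ']

theorem euler_pow {w : A} {c : ℂ} (hw : euler D z w = c • w) (s : ℕ) :
    euler D z (w ^ s) = (s * c : ℂ) • w ^ s := by
  induction s with
  | zero => simp [euler_apply]
  | succ s ih =>
    rw [pow_succ, euler_mul, ih, hw, smul_mul_assoc, mul_smul_comm, ← add_smul]
    push_cast
    ring_nf

theorem euler_self (hz : D z = 1) : euler D z z = (1 : ℂ) • z := by simp [euler_apply, hz]

theorem euler_inv (hz : D z = 1) (hzZ : z * Z = 1) : euler D z Z = (-1 : ℂ) • Z := by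
  have h : euler D z (z * Z) = 0 := by rw [hzZ]; simp [euler_apply]
  rw [euler_mul, euler_self hz, one_smul] at h
  have h2 : Z * (z * Z + z * euler D z Z) = 0 := by rw [h, mul_zero]
  have : euler D z Z = -Z := by linear_combination h2 - (Z + euler D z Z) * hzZ
  simpa using this

theorem euler_self_pow (hz : D z = 1) (s : ℕ) : euler D z (z ^ s) = (s : ℂ) • z ^ s := by
  simpa using euler_pow (euler_self hz) s

theorem euler_inv_pow (hz : D z = 1) (hzZ : z * Z = 1) (s : ℕ) :
    euler D z (Z ^ s) = (-s : ℂ) • Z ^ s := by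
  simpa using euler_pow (euler_inv hz hzZ) s

theorem aeval_euler_descPochhammer (hz : D z = 1) (k : ℕ) (a : A) :
    aeval (euler D z) (descPochhammer ℂ k) a = z ^ k * ((D : A →ₗ[ℂ] A) ^ k) a := by
  induction k with
  | zero => simp
  | succ k ih =>
    rw [descPochhammer_succ_right, mul_comm, map_mul, Module.End.mul_apply, ih]
    simp only [map_sub, aeval_X, map_natCast, LinearMap.sub_apply, Module.End.natCast_apply]
    rw [euler_mul, euler_self_pow hz, pow_succ' (D : A →ₗ[ℂ] A), Module.End.mul_apply, euler_apply,
      Nat.cast_smul_eq_nsmul, smul_mul_assoc]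
    simp only [Derivation.coeFn_coe]
    ring

/-- A homogeneous operator is `z^{-m} Q(θ)`. -/
theorem linOp_homogeneous (hz : D z = 1) (hzZ : z * Z = 1) (m : ℕ) (q : ℕ → ℂ) (a : A) :
    linOp D m (fun k => q k • Z ^ (m - k)) a =
      Z ^ m * aeval (euler D z)
        (∑ k ∈ Finset.range (m + 1), C (q k) * descPochhammer ℂ k) a := by
  rw [linOp_apply, map_sum, LinearMap.sum_apply, Finset.mul_sum]
  refine Finset.sum_congr rfl fun k hk => ?_
  have hk' : k ≤ m := by have := Finset.mem_range.mp hk; omega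
  rw [map_mul, Module.End.mul_apply, aeval_C, Module.algebraMap_end_apply,
    aeval_euler_descPochhammer hz, smul_mul_assoc, mul_smul_comm]
  congr 1
  have h : Z ^ k * z ^ k = 1 := by rw [← mul_pow, mul_comm, hzZ, one_pow]
  conv_rhs => rw [← Nat.sub_add_cancel hk', pow_add]
  linear_combination (-(Z ^ (m - k) * ((D : A →ₗ[ℂ] A) ^ k) a)) * h

/-- Moving powers of `Z = z⁻¹` to the left shifts `θ`; the two products become `z⁻ⁿ⁻ᵐ P(θ - m) Q(θ)`
and `z⁻ⁿ⁻ᵐ Q(θ - n) P(θ)`. -/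
theorem homogeneous_commute (hz : D z = 1) (hzZ : z * Z = 1) {n m : ℕ} {P Q : ℂ[X]}
    (h : P.comp (X - C (m : ℂ)) * Q = P * Q.comp (X - C (n : ℂ))) (a : A) :
    Z ^ n * aeval (euler D z) P (Z ^ m * aeval (euler D z) Q a) =
      Z ^ m * aeval (euler D z) Q (Z ^ n * aeval (euler D z) P a) := by
  rw [aeval_euler_mul (euler_inv_pow hz hzZ m), aeval_euler_mul (euler_inv_pow hz hzZ n),
    ← Module.End.mul_apply, ← Module.End.mul_apply, ← map_mul, ← map_mul, C_neg, C_neg,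
    ← sub_eq_add_neg, ← sub_eq_add_neg, h, mul_comm (Q.comp _)]
  ring

/-- An operator of order `m` commuting with `z^{-n} P(θ)` has a homogeneous top component. -/
theorem exists_shift_eq_of_commute (hz : D z = 1) (hzZ : z * Z = 1) {n m : ℕ} (hn : 1 ≤ n)
    {P : ℂ[X]} (hP : P.Monic) (hPn : P.natDegree = n) (c : ℕ → A) (ev : A →ₗ[ℂ] ℂ)
    (hc : ev (c m * Z ^ m) ≠ 0)
    (hcomm : ∀ a, Z ^ n * aeval (euler D z) P (linOp D m c a) =
      linOp D m c (Z ^ n * aeval (euler D z) P a)) :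
    ∃ Q : ℂ[X], Q ≠ 0 ∧ P.comp (X - C (m : ℂ)) * Q = P * Q.comp (X - C (n : ℂ)) := by
  set θ := euler D z
  let g : ℕ → A := fun s =>
    ∑ k ∈ Finset.range (m + 1), (descPochhammer ℂ k).eval (s : ℂ) • (c k * Z ^ k)
  have hpow : ∀ k, Z ^ k * z ^ k = 1 := fun k => by rw [← mul_pow, mul_comm, hzZ, one_pow]
  have hM : ∀ s, linOp D m c (z ^ s) = z ^ s * g s := by
    intro s
    rw [linOp_apply, Finset.mul_sum]
    refine Finset.sum_congr rfl fun k _ => ?_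
    have h := aeval_euler_descPochhammer (D := D) hz k (z ^ s)
    rw [aeval_euler_eigen (euler_self_pow hz s)] at h
    have h2 : ((D : A →ₗ[ℂ] A) ^ k) (z ^ s) =
        Z ^ k * ((descPochhammer ℂ k).eval (s : ℂ) • z ^ s) := by
      rw [h, ← mul_assoc, hpow, one_mul]
    rw [h2, mul_smul_comm, mul_smul_comm, mul_smul_comm]
    congr 1
    ring
  -- Commutation on `zˢ` with `s = t + n`, so that `z⁻ⁿ zˢ` is again a natural power.
  have hg : ∀ t, aeval θ (P.comp (X + C ((t + n : ℕ) : ℂ))) (g (t + n)) =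
      P.eval ((t + n : ℕ) : ℂ) • g t := by
    intro t
    have h := hcomm (z ^ (t + n))
    have h1 : Z ^ n * z ^ (t + n) = z ^ t := by
      rw [pow_add, mul_comm (z ^ t), ← mul_assoc, hpow, one_mul]
    rw [hM, aeval_euler_mul (euler_self_pow hz _), aeval_euler_eigen (euler_self_pow hz _),
      mul_smul_comm, h1, map_smul, hM, ← mul_assoc, h1] at h
    have h2 := congrArg (Z ^ t * ·) h
    simpa only [← mul_assoc, hpow, one_mul, mul_smul_comm] using h2
  -- The variable `s` enters `g` only through falling factorials, so `ev (θʲ g_s)` is polynomial in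
  -- `s`.
  let F : ℕ → ℂ[X] := fun j =>
    ∑ k ∈ Finset.range (m + 1), C (ev ((θ ^ j) (c k * Z ^ k))) * descPochhammer ℂ k
  have hF : ∀ j (s : ℕ), (F j).eval (s : ℂ) = ev ((θ ^ j) (g s)) := by
    intro j s
    simp only [F, g, eval_finsetSum, map_sum, map_smul, eval_mul, eval_C, smul_eq_mul]
    exact Finset.sum_congr rfl fun k _ => mul_comm _ _
  have htop : ∀ j, (F j).coeff m = ev ((θ ^ j) (c m * Z ^ m)) := by
    intro j
    simp only [F, finsetSum_coeff, coeff_C_mul]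
    rw [Finset.sum_range_succ, coeff_descPochhammer_self, mul_one, Finset.sum_eq_zero, zero_add]
    intro k hk
    have := Finset.mem_range.mp hk
    rw [coeff_eq_zero_of_natDegree_lt (by rw [descPochhammer_natDegree]; omega), mul_zero]
  refine exists_shift_eq_of_mem hn hP hPn (F := F) ⟨?_, ?_⟩ ?_
  · intro j i hi
    simp only [F, finsetSum_coeff, coeff_C_mul]
    refine Finset.sum_eq_zero fun k hk => ?_
    have := Finset.mem_range.mp hk
    rw [coeff_eq_zero_of_natDegree_lt (by rw [descPochhammer_natDegree]; omega), mul_zero]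
  · intro j
    -- It suffices to check the integers `s ≥ n`, where the recurrence is `hg` after `θʲ`, with `P(θ
    -- + s)` expanded in powers of `θ`.
    refine eq_of_infinite_eval_eq _ _ ?_
    refine Set.Infinite.mono (s := Set.range fun t : ℕ => ((t + n : ℕ) : ℂ)) ?_
      (Set.infinite_range_of_injective fun s t h => by
        have : s + n = t + n := by exact_mod_cast h
        omega)
    rintro _ ⟨t, rfl⟩
    simp only [Set.mem_ofPred_eq, eval_finsetSum, eval_mul, eval_comp, eval_sub, eval_X, eval_C]
    have ht : ((t + n : ℕ) : ℂ) - n = (t : ℕ) := by push_cast; ring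
    rw [ht, hF]
    simp only [hF]
    have h := congrArg (fun a => ev ((θ ^ j) a)) (hg t)
    simp only [map_smul, smul_eq_mul] at h
    rw [← h, ← taylor_apply, aeval_eq_sum_range, natDegree_taylor, hPn]
    simp only [LinearMap.sum_apply, LinearMap.smul_apply, map_sum, map_smul, smul_eq_mul,
      taylor_coeff, pow_add, Module.End.mul_apply]
  · rw [htop]
    simpa using hc

end Euler
-- Smooth functions on an open set as a differential algebra
open scoped ContDiff

section SmoothFunctions

variable {I : Set ℝ}

/-- Extension by zero of a function on `I`. -/
noncomputable def zeroExt (f : I → ℂ) : ℝ → ℂ := Function.extend Subtype.val f 0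

theorem zeroExt_apply (f : I → ℂ) (x : I) : zeroExt f x = f x :=
  Subtype.val_injective.extend_apply f 0 x

theorem zeroExt_restrict_eqOn (f : ℝ → ℂ) : Set.EqOn (zeroExt (fun x : I => f x)) f I :=
  fun x hx => zeroExt_apply (fun x : I => f x) ⟨x, hx⟩

/-- The algebra of smooth complex-valued functions on `I`. -/
noncomputable def smoothAlg (I : Set ℝ) : Subalgebra ℂ (I → ℂ) where
  carrier := {f | ContDiffOn ℝ ∞ (zeroExt f) I}
  mul_mem' {f g} hf hg := (ContDiffOn.mul hf hg).congr fun x hx => by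
    rw [zeroExt_apply _ ⟨x, hx⟩]
    simp [zeroExt_apply f ⟨x, hx⟩, zeroExt_apply g ⟨x, hx⟩]
  add_mem' {f g} hf hg := (ContDiffOn.add hf hg).congr fun x hx => by
    rw [zeroExt_apply _ ⟨x, hx⟩]
    simp [zeroExt_apply f ⟨x, hx⟩, zeroExt_apply g ⟨x, hx⟩]
  algebraMap_mem' c := (contDiffOn_const (c := c)).congr fun x hx => by
    rw [zeroExt_apply _ ⟨x, hx⟩]; rfl

/-- The restriction to `I` of a function that is smooth there. -/
noncomputable def toSmooth (f : ℝ → ℂ) (hf : ContDiffOn ℝ ∞ f I) : smoothAlg I :=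
  ⟨fun x => f x, hf.congr (zeroExt_restrict_eqOn f)⟩

@[simp] theorem toSmooth_apply (f : ℝ → ℂ) (hf : ContDiffOn ℝ ∞ f I) (x : I) :
    (toSmooth f hf : I → ℂ) x = f x := rfl

theorem contDiffOn_deriv (hI : IsOpen I) {f : ℝ → ℂ} (hf : ContDiffOn ℝ ∞ f I) :
    ContDiffOn ℝ ∞ (deriv f) I :=
  hf.deriv_of_isOpen hI (by simp)

theorem contDiffOn_iteratedDeriv (hI : IsOpen I) {f : ℝ → ℂ} (hf : ContDiffOn ℝ ∞ f I) (k : ℕ) :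
    ContDiffOn ℝ ∞ (iteratedDeriv k f) I := by
  induction k with
  | zero => simpa using hf
  | succ k ih => rw [iteratedDeriv_succ]; exact contDiffOn_deriv hI ih

theorem hasDerivAt_zeroExt (hI : IsOpen I) (f : smoothAlg I) (x : I) :
    HasDerivAt (zeroExt (f : I → ℂ)) (deriv (zeroExt (f : I → ℂ)) x) x :=
  ((ContDiffOn.differentiableOn f.2 (by simp)).differentiableAt
    (hI.mem_nhds x.2)).hasDerivAt

/-- Derivatives at points of the open set `I` are local, so the zero extension may be replaced by
any other extension. -/
theorem deriv_zeroExt_eq (hI : IsOpen I) (f : I → ℂ) {g : ℝ → ℂ} {g' : ℂ} (x : I)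
    (h : ∀ y : I, f y = g y) (hg : HasDerivAt g g' x) : deriv (zeroExt f) x = g' := by
  refine (hg.congr_of_eventuallyEq ?_).deriv
  filter_upwards [hI.mem_nhds x.2] with y hy
  rw [zeroExt_apply f ⟨y, hy⟩, h]

/-- Differentiation of smooth functions on the open set `I`. -/
noncomputable def smoothDeriv (hI : IsOpen I) : Derivation ℂ (smoothAlg I) (smoothAlg I) :=
  Derivation.mk'
    { toFun := fun f => toSmooth (deriv (zeroExt (f : I → ℂ))) (contDiffOn_deriv hI f.2)
      map_add' := fun f g => Subtype.ext <| funext fun x =>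
        deriv_zeroExt_eq hI _ x (fun y => by simp [zeroExt_apply])
          ((hasDerivAt_zeroExt hI f x).add (hasDerivAt_zeroExt hI g x))
      map_smul' := fun c f => Subtype.ext <| funext fun x =>
        deriv_zeroExt_eq hI _ x (fun y => by simp [zeroExt_apply])
          ((hasDerivAt_zeroExt hI f x).const_mul c) }
    fun f g => Subtype.ext <| funext fun x =>
      (deriv_zeroExt_eq hI _ x (fun y => by simp [zeroExt_apply])
        ((hasDerivAt_zeroExt hI f x).mul (hasDerivAt_zeroExt hI g x))).trans <| by
          simp [zeroExt_apply]; ring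

theorem smoothDeriv_toSmooth (hI : IsOpen I) {f : ℝ → ℂ} (hf : ContDiffOn ℝ ∞ f I) :
    smoothDeriv hI (toSmooth f hf) = toSmooth (deriv f) (contDiffOn_deriv hI hf) :=
  Subtype.ext <| funext fun x => deriv_zeroExt_eq hI _ x (fun _ => rfl)
    ((hf.differentiableOn (by simp)).differentiableAt (hI.mem_nhds x.2)).hasDerivAt

theorem smoothDeriv_pow_toSmooth (hI : IsOpen I) {f : ℝ → ℂ} (hf : ContDiffOn ℝ ∞ f I) (k : ℕ) :
    ((smoothDeriv hI : smoothAlg I →ₗ[ℂ] smoothAlg I) ^ k) (toSmooth f hf) =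
      toSmooth (iteratedDeriv k f) (contDiffOn_iteratedDeriv hI hf k) := by
  induction k with
  | zero => simp
  | succ k ih =>
    rw [pow_succ', Module.End.mul_apply, ih]
    simp only [iteratedDeriv_succ]
    exact smoothDeriv_toSmooth hI _

/-- The coordinate function. -/
noncomputable def coordFn (I : Set ℝ) : smoothAlg I :=
  toSmooth (fun x => (x : ℂ)) Complex.ofRealCLM.contDiff.contDiffOn

theorem contDiffOn_coord_inv (h0 : (0 : ℝ) ∉ I) : ContDiffOn ℝ ∞ (fun x : ℝ => (x : ℂ)⁻¹) I :=
  ContDiffOn.inv Complex.ofRealCLM.contDiff.contDiffOn fun _ hx =>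
    Complex.ofReal_ne_zero.mpr fun h => h0 (h ▸ hx)

/-- The inverse of the coordinate function. -/
noncomputable def coordInv (h0 : (0 : ℝ) ∉ I) : smoothAlg I :=
  toSmooth (fun x => (x : ℂ)⁻¹) (contDiffOn_coord_inv h0)

theorem coordFn_mul_coordInv (h0 : (0 : ℝ) ∉ I) : coordFn I * coordInv h0 = 1 :=
  Subtype.ext <| funext fun x => mul_inv_cancel₀ <|
    Complex.ofReal_ne_zero.mpr fun h => h0 (h ▸ x.2)

theorem smoothDeriv_coordFn (hI : IsOpen I) : smoothDeriv hI (coordFn I) = 1 :=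
  Subtype.ext <| funext fun x => deriv_zeroExt_eq hI _ x (fun _ => rfl)
    (Complex.ofRealCLM.hasDerivAt (x := (x : ℝ)))

open Classical in
/-- The coefficients of a differential operator as elements of the algebra of smooth functions. -/
noncomputable def DiffOp.smoothCoeff {m : ℕ} (M : DiffOp I m) (k : ℕ) : smoothAlg I :=
  -- Smoothness is known only up to the order; the value `0` beyond it never enters `linOp`.
  if hk : k ≤ m then toSmooth (M.coeff k) (M.smooth k hk) else 0

theorem DiffOp.smoothCoeff_apply {m : ℕ} (M : DiffOp I m) {k : ℕ} (hk : k ≤ m) (x : I) :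
    (M.smoothCoeff k : I → ℂ) x = M.coeff k x := by
  rw [smoothCoeff, dif_pos hk, toSmooth_apply]

theorem DiffOp.act_eq (hI : IsOpen I) {m : ℕ} (M : DiffOp I m) {f : ℝ → ℂ}
    (hf : ContDiffOn ℝ ∞ f I) (x : I) :
    M.act f x = (linOp (smoothDeriv hI) m M.smoothCoeff (toSmooth f hf) : I → ℂ) x := by
  rw [linOp_apply, DiffOp.act, AddSubmonoidClass.coe_finsetSum, Finset.sum_apply]
  refine Finset.sum_congr rfl fun k hk => ?_
  have hk' : k ≤ m := by have := Finset.mem_range.mp hk; omega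
  rw [smoothDeriv_pow_toSmooth hI hf]
  exact congrArg (· * _) (M.smoothCoeff_apply hk' x).symm

theorem DiffOp.contDiffOn_act (hI : IsOpen I) {m : ℕ} (M : DiffOp I m) {f : ℝ → ℂ}
    (hf : ContDiffOn ℝ ∞ f I) : ContDiffOn ℝ ∞ (M.act f) I :=
  ContDiffOn.congr (linOp (smoothDeriv hI) m M.smoothCoeff (toSmooth f hf)).2 fun x hx => by
    rw [M.act_eq hI hf ⟨x, hx⟩, zeroExt_apply _ ⟨x, hx⟩]

theorem DiffOp.toSmooth_act (hI : IsOpen I) {m : ℕ} (M : DiffOp I m) {f : ℝ → ℂ}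
    (hf : ContDiffOn ℝ ∞ f I) : toSmooth (M.act f) (M.contDiffOn_act hI hf) =
      linOp (smoothDeriv hI) m M.smoothCoeff (toSmooth f hf) :=
  Subtype.ext <| funext fun x => M.act_eq hI hf x

theorem DiffOp.commutes_iff (hI : IsOpen I) {n m : ℕ} (L : DiffOp I n) (M : DiffOp I m) :
    L.Commutes M ↔ ∀ a : smoothAlg I,
      linOp (smoothDeriv hI) n L.smoothCoeff (linOp (smoothDeriv hI) m M.smoothCoeff a) =
        linOp (smoothDeriv hI) m M.smoothCoeff (linOp (smoothDeriv hI) n L.smoothCoeff a) := by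
  constructor
  · intro h a
    have has : ContDiffOn ℝ ∞ (zeroExt (a : I → ℂ)) I := a.2
    have ha : a = toSmooth (zeroExt (a : I → ℂ)) has :=
      Subtype.ext <| funext fun x => (zeroExt_apply _ x).symm
    rw [ha, ← M.toSmooth_act hI, ← L.toSmooth_act hI, ← L.toSmooth_act hI, ← M.toSmooth_act hI]
    exact Subtype.ext <| funext fun x => h _ has x.2
  · intro h f hf x hx
    have := h (toSmooth f hf)
    rw [← M.toSmooth_act hI, ← L.toSmooth_act hI, ← L.toSmooth_act hI, ← M.toSmooth_act hI] at this
    exact congrFun (congrArg Subtype.val this) ⟨x, hx⟩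

/-- The homogeneous operator of order `m` with coefficients `q_k z^{k-m}`. -/
noncomputable def homogeneousDiffOp (hne : I.Nonempty) (h0 : (0 : ℝ) ∉ I) (m : ℕ) (q : ℕ → ℂ)
    (hq : q m ≠ 0) : DiffOp I m where
  coeff k x := q k * (x : ℂ)⁻¹ ^ (m - k)
  smooth k _ := contDiffOn_const.mul ((contDiffOn_coord_inv h0).pow _)
  leading_ne_zero := by
    obtain ⟨x, hx⟩ := hne
    exact ⟨x, hx, by simpa using hq⟩

theorem linOp_homogeneousDiffOp (hI : IsOpen I) (hne : I.Nonempty) (h0 : (0 : ℝ) ∉ I) (m : ℕ)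
    (q : ℕ → ℂ) (hq : q m ≠ 0) (a : smoothAlg I) :
    linOp (smoothDeriv hI) m (homogeneousDiffOp hne h0 m q hq).smoothCoeff a =
      coordInv h0 ^ m * aeval (euler (smoothDeriv hI) (coordFn I))
        (∑ k ∈ Finset.range (m + 1), C (q k) * descPochhammer ℂ k) a := by
  rw [← linOp_homogeneous (smoothDeriv_coordFn hI) (coordFn_mul_coordInv h0), linOp_apply,
    linOp_apply]
  refine Finset.sum_congr rfl fun k hk => congrArg (· * _) ?_
  have hk' : k ≤ m := by have := Finset.mem_range.mp hk; omega
  exact Subtype.ext <| funext fun x => DiffOp.smoothCoeff_apply _ hk' x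

theorem linOp_homogeneousOp (hI : IsOpen I) (hne : I.Nonempty) (h0 : (0 : ℝ) ∉ I) {n : ℕ}
    (hn : 1 ≤ n) (b : ℕ → ℂ) (a : smoothAlg I) :
    linOp (smoothDeriv hI) n (homogeneousOp n b I hne h0).smoothCoeff a =
      coordInv h0 ^ n * aeval (euler (smoothDeriv hI) (coordFn I)) (indicialPoly n b) a := by
  rw [indicialPoly_eq_sum hn,
    ← linOp_homogeneousDiffOp hI hne h0 n _ (by simp [homogeneousNumerator]), linOp_apply,
    linOp_apply]
  refine Finset.sum_congr rfl fun k hk => congrArg (· * _) ?_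
  have hk' : k ≤ n := by have := Finset.mem_range.mp hk; omega
  refine Subtype.ext <| funext fun x => ?_
  rw [DiffOp.smoothCoeff_apply _ hk', DiffOp.smoothCoeff_apply _ hk']
  simp only [homogeneousOp, homogeneousDiffOp, homogeneousCoeff, homogeneousNumerator]
  split_ifs with h1 h2
  · simp [h1]
  · simp
  · rw [inv_pow, div_eq_mul_inv]

end SmoothFunctions

/-! ### Integrality of the indices and the equivalence -/

theorem integer_roots_of_shift_eq {n m : ℕ} (hn : 1 ≤ n) (hmn : m.Coprime n) (b : ℕ → ℂ)
    {Q : ℂ[X]} (hQ : Q ≠ 0)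
    (h : (indicialPoly n b).comp (X - C (m : ℂ)) * Q =
      indicialPoly n b * Q.comp (X - C (n : ℂ))) :
    ∃ a : Fin n → ℤ,
      indices n b = (Finset.univ : Finset (Fin n)).val.map (fun j => (a j : ℂ)) ∧
      ∀ i j : Fin n, i ≠ j → ¬ (a i ≡ a j [ZMOD (n : ℤ)]) := by
  obtain ⟨α, k, hroots⟩ := exists_roots_of_shift_eq hn hmn (monic_indicialPoly hn b)
    (natDegree_indicialPoly hn b) hQ h
  have hn0 : (n : ℂ) ≠ 0 := by exact_mod_cast (by omega : n ≠ 0)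
  -- The sum of the roots is both `n α + ∑ i + n ∑ k i` and `∑ i`, which forces `α` to be an
  -- integer.
  have hα : α = ((-∑ i, k i : ℤ) : ℂ) := by
    have hs := sum_roots_indicialPoly hn b
    rw [hroots, Finset.sum_map_val, Finset.sum_add_distrib, Finset.sum_add_distrib,
      Fin.sum_univ_eq_sum_range (fun i => (i : ℂ)), ← Finset.sum_mul] at hs
    simp only [Finset.sum_const, Finset.card_univ, Fintype.card_fin, nsmul_eq_mul] at hs
    apply mul_left_cancel₀ hn0
    push_cast
    linear_combination hs
  refine ⟨fun i => -∑ i, k i + (i : ℕ) + k i * n, ?_, ?_⟩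
  · rw [indices, hroots, hα]
    push_cast
    rfl
  · intro i j hij hmod
    apply hij
    have h1 : ((i : ℕ) : ℤ) ≡ (j : ℕ) [ZMOD n] := by
      have h2 := (Int.modEq_iff_dvd.mp hmod)
      rw [Int.modEq_iff_dvd]
      have h3 : ((j : ℕ) : ℤ) - (i : ℕ) =
          (-∑ i, k i + (j : ℕ) + k j * n - (-∑ i, k i + (i : ℕ) + k i * n)) +
            n * (k i - k j) := by ring
      rw [h3]
      exact dvd_add h2 (dvd_mul_right _ _)
    rw [Int.ModEq, Int.emod_eq_of_lt (by positivity) (by exact_mod_cast i.2),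
      Int.emod_eq_of_lt (by positivity) (by exact_mod_cast j.2)] at h1
    exact Fin.ext (by exact_mod_cast h1)

theorem mainTheorem8 (n : ℕ) (hn : 1 ≤ n) (b : ℕ → ℂ)
    (I : Set ℝ) (hopen : IsOpen I) (hconn : I.OrdConnected) (hne : I.Nonempty)
    (h0 : (0 : ℝ) ∉ I) :
    (homogeneousOp n b I hne h0).AlgebraicallyIntegrable ↔
      ∃ m : Fin n → ℤ,
        indices n b = (Finset.univ : Finset (Fin n)).val.map (fun j => (m j : ℂ)) ∧
        ∀ i j : Fin n, i ≠ j → ¬ (m i ≡ m j [ZMOD (n : ℤ)]) := by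
  have hz := smoothDeriv_coordFn hopen
  have hzZ := coordFn_mul_coordInv h0
  constructor
  · rintro ⟨m, hmn, M, hM⟩
    rw [DiffOp.commutes_iff hopen] at hM
    simp only [linOp_homogeneousOp hopen hne h0 hn] at hM
    obtain ⟨x, hx, hxne⟩ := M.leading_ne_zero
    -- Evaluation at a point where the leading coefficient of `M` does not vanish.
    let ev : smoothAlg I →ₗ[ℂ] ℂ :=
      (LinearMap.proj (⟨x, hx⟩ : I)).comp (smoothAlg I).val.toLinearMap
    have hev : ev (M.smoothCoeff m * coordInv h0 ^ m) ≠ 0 := by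
      change (M.smoothCoeff m : I → ℂ) ⟨x, hx⟩ * ((x : ℂ)⁻¹) ^ m ≠ 0
      rw [M.smoothCoeff_apply le_rfl]
      refine mul_ne_zero hxne (pow_ne_zero _ (inv_ne_zero ?_))
      exact Complex.ofReal_ne_zero.mpr fun h => h0 (h ▸ hx)
    obtain ⟨Q, hQ, h⟩ := exists_shift_eq_of_commute hz hzZ hn (monic_indicialPoly hn b)
      (natDegree_indicialPoly hn b) _ ev hev hM
    exact integer_roots_of_shift_eq hn hmn b hQ h
  · rintro ⟨a, ha, hmod⟩
    obtain ⟨m, hmn, Q, hQ, hQm, h⟩ := exists_shift_eq_of_residues hn a hmod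
    have hP : indicialPoly n b = ∏ i, (X - C (a i : ℂ)) := by
      rw [(IsAlgClosed.splits (indicialPoly n b)).eq_prod_roots_of_monic (monic_indicialPoly hn b)]
      change ((indices n b).map _).prod = _
      rw [ha, Multiset.map_map]
      rfl
    rw [← hP] at h
    obtain ⟨q, hq, hqm⟩ := exists_descPochhammer_expansion m Q hQm.le
    have hqm' : q m ≠ 0 := by
      rw [hqm, ← hQm, coeff_natDegree, hQ.leadingCoeff]
      exact one_ne_zero
    refine ⟨m, hmn, homogeneousDiffOp hne h0 m q hqm', ?_⟩
    rw [DiffOp.commutes_iff hopen]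
    intro f
    simp only [linOp_homogeneousOp hopen hne h0 hn, linOp_homogeneousDiffOp hopen hne h0, ← hq]
    exact homogeneous_commute hz hzZ h f
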